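/- Let $Y,\psi_L,\psi_U$ be integrable real random variables on a probability space, with $\psi_L\le\psi_U$ almost surely ($\psi_L$ and $\psi_U$ are the observed bounds of an unobserved belief $\psi$, $\psi_L\le\psi\le\psi_U$). Write $F_X(t)=P(X\le t)$ for the cdf of a real random variable $X$. For $b\in\mathbb R$ let $$\psi^b=\psi_U\,\mathbf 1\{\psi_U<b\}+\max(b,\psi_L)\,\mathbf 1\{\psi_U\ge b\},$$ and let $\psi^{-\infty}=\psi_L$, $\psi^{+\infty}=\psi_U$. Let $F^b$ be the cdf of $\psi^b$ and $\mathcal F_B=\{F^b : b\in\overline{\mathbb R}\}$. For $F\in\mathcal F_B$ and $y\in\mathbb R$ put $$\delta_F=E[Y]-\int u\,dF(u),\qquad \Delta_F(y)=\int_{-\infty}^y\bigl(F_Y(t)-F(t)\bigr)\,dt .$$ Let $\mathrm H_{0B}$ be the hypothesis that, on some probability space, there exist real random variables $Y',\psi'$ and a $\sigma$-algebra $\mathcal I'$ of events with $\sigma(\psi')\subset\mathcal I'$ such that $Y'$ has the same distribution as $Y$, $F_{\psi_U}(t)\le F_{\psi'}(t)\le F_{\psi_L}(t)$ for all $t\in\mathbb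 R$, and $E[Y'\mid\mathcal I']=\psi'$ almost surely. Then the integrals defining $\delta_F$ and $\Delta_F(y)$ converge absolutely for all $F\in\mathcal F_B$ and $y\in\mathbb R$, and the following hold. 1. If $E[\psi_L]\le E[Y]\le E[\psi_U]$, there is a unique $F^*\in\mathcal F_B$ such that $\delta_{F^*}=0$. 2. $\mathrm H_{0B}$ holds if and only if $E[\psi_L]\le E[Y]\le E[\psi_U]$ and $\Delta_{F^*}(y)\ge 0$ for all $y\in\mathbb R$, where $F^*$ is the cdf of part 1. -/

import Mathlib

open MeasureTheory ProbabilityTheory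

universe u v

namespace BeliefBounds

noncomputable section

/-- The cumulative distribution function of the real random variable `X` under `P`. -/
def cdfOf {Ω : Type u} [MeasurableSpace Ω] (P : Measure Ω) (X : Ω → ℝ) : StieltjesFunction ℝ :=
  cdf (P.map X)

/-- The candidate beliefs: `ψL` for `b = -∞`, `ψU` for `b = +∞`, and, for a real number `b`,
`ψU` where `ψU < b` and `max b ψL` where `b ≤ ψU`. -/
def psiB {Ω : Type u} (ψL ψU : Ω → ℝ) (b : EReal) (ω : Ω) : ℝ :=
  if b = ⊥ then ψL ω
  else if b = ⊤ then ψU ω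
  else if ψU ω < b.toReal then ψU ω
  else max b.toReal (ψL ω)

/-- The family of the cdfs of the candidate beliefs, for `b` in the extended real line. -/
def familyB {Ω : Type u} [MeasurableSpace Ω] (P : Measure Ω) (ψL ψU : Ω → ℝ) :
    Set (StieltjesFunction ℝ) :=
  Set.range fun b : EReal => cdfOf P (psiB ψL ψU b)

/-- `δ_F = E[Y] - ∫ u dF(u)`. -/
def deltaMean {Ω : Type u} [MeasurableSpace Ω] (P : Measure Ω) (Y : Ω → ℝ)
    (F : StieltjesFunction ℝ) : ℝ :=
  (∫ ω, Y ω ∂P) - ∫ x, x ∂F.measure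

/-- `Δ_F(y) = ∫_{-∞}^y (F_Y(t) - F(t)) dt`. -/
def Delta {Ω : Type u} [MeasurableSpace Ω] (P : Measure Ω) (Y : Ω → ℝ)
    (F : StieltjesFunction ℝ) (y : ℝ) : ℝ :=
  ∫ t in Set.Iic y, (cdfOf P Y t - F t)

/-- Rational expectations can be rationalized given bounds on beliefs: on some probability space
there are random variables `Y'`, `ψ'` and a sigma-algebra `I'` containing `σ(ψ')` such that `Y'`
is distributed as `Y`, the cdf of `ψ'` lies between those of `ψU` and `ψL`, and
`E[Y' | I'] = ψ'` almost surely. -/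
def H0B {Ω : Type u} [MeasurableSpace Ω] (P : Measure Ω) (Y ψL ψU : Ω → ℝ) : Prop :=
  ∃ (Ω' : Type v) (I' mΩ' : MeasurableSpace Ω') (P' : Measure Ω') (_ : IsProbabilityMeasure P')
    (Y' ψ' : Ω' → ℝ),
    I' ≤ mΩ' ∧ Measurable[mΩ'] Y' ∧
    MeasurableSpace.comap ψ' Real.measurableSpace ≤ I' ∧
    IdentDistrib Y' Y P' P ∧
    (∀ t : ℝ, cdfOf P ψU t ≤ cdfOf P' ψ' t ∧ cdfOf P' ψ' t ≤ cdfOf P ψL t) ∧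
    P'[Y' | I'] =ᵐ[P'] ψ'

/-- The cdf of the candidate belief with real parameter `b` is that of `ψU` on `t < b` and that
of `ψL` on `b ≤ t`. -/
theorem cdfOf_psiB {Ω : Type u} [MeasurableSpace Ω] (P : Measure Ω) [IsProbabilityMeasure P]
    {ψL ψU : Ω → ℝ} (hL : AEMeasurable ψL P) (hU : AEMeasurable ψU P)
    (hLU : ∀ᵐ ω ∂P, ψL ω ≤ ψU ω) (b t : ℝ) :
    cdfOf P (psiB ψL ψU (b : EReal)) t = if t < b then cdfOf P ψU t else cdfOf P ψL t := by
  have hB : AEMeasurable (psiB ψL ψU (b : EReal)) P := by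
    refine ⟨psiB (hL.mk ψL) (hU.mk ψU) b, ?_, ?_⟩
    · have h0 : psiB (hL.mk ψL) (hU.mk ψU) (b : EReal) = fun ω =>
          if hU.mk ψU ω < b then hU.mk ψU ω else max b (hL.mk ψL ω) := by
        funext ω
        rw [psiB, if_neg (EReal.coe_ne_bot b), if_neg (EReal.coe_ne_top b)]
        rfl
      rw [h0]
      exact Measurable.ite (measurableSet_lt hU.measurable_mk measurable_const)
        hU.measurable_mk (measurable_const.max hL.measurable_mk)
    · filter_upwards [hL.ae_eq_mk, hU.ae_eq_mk] with ω h1 h2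
      simp only [psiB, h1, h2]
  have key : ∀ X : Ω → ℝ, AEMeasurable X P → cdfOf P X t = P.real {ω | X ω ≤ t} := by
    intro X hX
    have := Measure.isProbabilityMeasure_map hX
    rw [cdfOf, cdf_eq_real, Measure.real, Measure.map_apply_of_aemeasurable hX measurableSet_Iic]
    rfl
  rw [key _ hB, key _ hU, key _ hL]
  split_ifs with h
  all_goals
    refine measureReal_congr ?_
    filter_upwards [hLU] with ω hω
    apply propext
    change psiB ψL ψU b ω ≤ t ↔ _ ≤ t
    simp only [psiB, EReal.coe_ne_bot, EReal.coe_ne_top, if_false, EReal.toReal_coe]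
    split_ifs with h2
    all_goals grind

end

end BeliefBounds

open BeliefBounds

/-! The clipped belief ψ^b = max(ψL, min(b, ψU)) has cdf F_U below b and F_L from b on. A cdf F
between F_U and F_L is thus at least F^b below b and at most F^b from b on; if the means agree, this
single crossing puts F^b below F in convex order (`cdfOf_psiB_cut`,
`integral_max_const_sub_le_of_cut`). So F* is the least dispersed admissible law with mean E[Y]. It
exists because the mean of ψ^b is continuous in b with limits E[ψL] and E[ψU], and is unique because
ψ^b is monotone in b.

By Tonelli, Δ_F(y) = E(y - Y)⁺ - ∫ (y - x)⁺ dF(x), so for equal means Δ ≥ 0 says that F* is below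
F_Y in convex order. If the hypothesis holds, Jensen puts ψ' below Y', and F* is below the law of
ψ'. Conversely, a martingale coupling of F* and F_Y supplies ψ' and Y'.

That coupling (`exists_martingale_coupling`) is built from the quantile functions f, g of the two
laws. Convex order gives ∫_0^t g ≤ ∫_0^t f, so the measures (f - g)⁺ du and (g - f)⁺ du, of equal
mass, have a coupling supported on u ≤ v. There g(u) < f(u) ≤ f(v) < g(v), and the mass at f(u) and
f(v) can be split between g(u) and g(v) with barycentres kept (`exists_martingale_splice`). Where f
= g the mass stays put. -/

namespace BeliefBounds
open Set Filter Topology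

/-! ### Quantile functions and ordered couplings -/

/-- A probability measure on the line has a measurable quantile function. -/
theorem exists_quantile_of_isProbabilityMeasure (μ : Measure ℝ) [IsProbabilityMeasure μ] :
    ∃ q : ℝ → ℝ, Measurable q ∧ ∀ u ∈ Ioo (0 : ℝ) 1, ∀ x, q u ≤ x ↔ u ≤ μ.real (Iic x) := by
  have key : ∀ u ∈ Ioo (0 : ℝ) 1, ∀ x, sInf {x | u ≤ cdf μ x} ≤ x ↔ u ≤ cdf μ x := by
    intro u hu x
    have hne : {x | u ≤ cdf μ x}.Nonempty := by
      obtain ⟨y, hy⟩ := ((tendsto_cdf_atTop μ).eventually (eventually_gt_nhds hu.2)).exists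
      exact ⟨y, hy.le⟩
    have hbdd : BddBelow {x | u ≤ cdf μ x} := by
      obtain ⟨y, hy⟩ := ((tendsto_cdf_atBot μ).eventually (eventually_lt_nhds hu.1)).exists
      refine ⟨y, fun z hz => ?_⟩
      by_contra! h
      exact absurd (hz.trans (monotone_cdf μ h.le)) (not_le.2 hy)
    refine ⟨fun h => ?_, fun h => csInf_le hbdd h⟩
    -- The infimum is attained by right continuity: the level u is reached at every point to the
    -- right of x.
    have hev : ∀ᶠ y in 𝓝[>] x, u ≤ cdf μ y := by
      filter_upwards [self_mem_nhdsWithin] with y hy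
      obtain ⟨z, hz, hzy⟩ := exists_lt_of_csInf_lt hne (h.trans_lt hy)
      exact le_trans hz (monotone_cdf μ hzy.le)
    exact ge_of_tendsto
      (((cdf μ).right_continuous x).mono_left (nhdsWithin_mono x Ioi_subset_Ici_self)) hev
  -- Off (0, 1) the infimum may be degenerate; the value 0 there keeps the sublevel sets explicit.
  refine ⟨(Ioo (0 : ℝ) 1).indicator fun u => sInf {x | u ≤ cdf μ x}, ?_, ?_⟩
  · refine measurable_of_Iic fun x => ?_
    have h : ((Ioo (0 : ℝ) 1).indicator fun u => sInf {x | u ≤ cdf μ x}) ⁻¹' Iic x =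
        (Ioo 0 1 ∩ Iic (cdf μ x)) ∪ ((Ioo 0 1)ᶜ ∩ {_u | 0 ≤ x}) := by
      ext u
      by_cases hu : u ∈ Ioo (0 : ℝ) 1
      · simp only [mem_preimage, indicator_of_mem hu, mem_Iic, key u hu, mem_union, mem_inter_iff,
          hu, true_and, mem_compl_iff, not_true_eq_false, false_and, or_false]
      · simp only [mem_preimage, indicator_of_notMem hu, mem_Iic, mem_union, mem_inter_iff,
          hu, false_and, mem_compl_iff, not_false_eq_true, true_and, false_or, mem_ofPred_eq]
    rw [h]
    exact (measurableSet_Ioo.inter measurableSet_Iic).union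
      (measurableSet_Ioo.compl.inter (MeasurableSet.const _))
  · intro u hu x
    rw [indicator_of_mem hu, key u hu, cdf_eq_real]

/-- A finite measure on the line has a measurable quantile function. -/
theorem exists_quantile (μ : Measure ℝ) [IsFiniteMeasure μ] :
    ∃ q : ℝ → ℝ, Measurable q ∧
      ∀ u ∈ Ioo (0 : ℝ) (μ.real univ), ∀ x, q u ≤ x ↔ u ≤ μ.real (Iic x) := by
  rcases eq_or_ne μ 0 with rfl | hμ
  · exact ⟨0, measurable_zero, by simp⟩
  have : NeZero μ := ⟨hμ⟩
  have hm : 0 < μ.real univ := measureReal_univ_pos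
  obtain ⟨q, hq, h⟩ := exists_quantile_of_isProbabilityMeasure ((μ univ)⁻¹ • μ)
  refine ⟨fun u => q (u / μ.real univ), hq.comp (measurable_id.div_const _), fun u hu x => ?_⟩
  rw [h _ ⟨div_pos hu.1 hm, (div_lt_one hm).2 hu.2⟩, measureReal_ennreal_smul_apply,
    ENNReal.toReal_inv, ← measureReal_def, div_le_iff₀ hm]
  field_simp

/-- The quantile function transports Lebesgue measure to the given measure. -/
theorem map_quantile {μ : Measure ℝ} [IsFiniteMeasure μ] {q : ℝ → ℝ} (hq : Measurable q)
    (h : ∀ u ∈ Ioo (0 : ℝ) (μ.real univ), ∀ x, q u ≤ x ↔ u ≤ μ.real (Iic x)) :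
    (volume.restrict (Ioo (0 : ℝ) (μ.real univ))).map q = μ := by
  refine Measure.ext_of_Iic _ _ fun x => ?_
  rw [Measure.map_apply hq measurableSet_Iic, Measure.restrict_apply (hq measurableSet_Iic)]
  have hle : μ.real (Iic x) ≤ μ.real univ := measureReal_mono (subset_univ _)
  have h1 : (q ⁻¹' Iic x ∩ Ioo 0 (μ.real univ) : Set ℝ) =ᵐ[volume] (Ioc 0 (μ.real (Iic x)) : Set ℝ) := by
    -- If x carries the full mass, the right endpoint lies in the `Ioc` but not in the domain of the
    -- quantile.
    have h0 : ∀ᵐ u : ℝ, u ≠ μ.real univ := by simp [ae_iff]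
    filter_upwards [h0] with u hu0
    apply propext
    change (q u ≤ x ∧ 0 < u ∧ u < μ.real univ) ↔ (0 < u ∧ u ≤ μ.real (Iic x))
    constructor
    · rintro ⟨h1, h2, h3⟩
      exact ⟨h2, (h u ⟨h2, h3⟩ x).1 h1⟩
    · rintro ⟨h2, h3⟩
      have h4 := lt_of_le_of_ne (h3.trans hle) hu0
      exact ⟨(h u ⟨h2, h4⟩ x).2 h3, h2, h4⟩
  rw [measure_congr h1, Real.volume_Ioc, sub_zero, measureReal_def,
    ENNReal.ofReal_toReal (measure_ne_top _ _)]

theorem monotoneOn_quantile {μ : Measure ℝ} {q : ℝ → ℝ}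
    (h : ∀ u ∈ Ioo (0 : ℝ) (μ.real univ), ∀ x, q u ≤ x ↔ u ≤ μ.real (Iic x)) :
    MonotoneOn q (Ioo (0 : ℝ) (μ.real univ)) :=
  fun u hu w hw huw => (h u hu _).2 (huw.trans ((h w hw _).1 le_rfl))

/-- Two measures of equal mass, ordered stochastically, have an ordered coupling. -/
theorem exists_ordered_coupling (μ ν : Measure ℝ) [IsFiniteMeasure μ] [IsFiniteMeasure ν]
    (huniv : μ univ = ν univ) (hle : ∀ t, ν (Iic t) ≤ μ (Iic t)) :
    ∃ Q : Measure (ℝ × ℝ), Q.map Prod.fst = μ ∧ Q.map Prod.snd = ν ∧ ∀ᵐ z ∂Q, z.1 ≤ z.2 := by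
  obtain ⟨p, hp, hpq⟩ := exists_quantile μ
  obtain ⟨q, hq, hqq⟩ := exists_quantile ν
  have hm : μ.real univ = ν.real univ := by rw [measureReal_def, huniv, measureReal_def]
  -- Both quantile functions are evaluated at the same uniform variable.
  refine ⟨(volume.restrict (Ioo (0 : ℝ) (μ.real univ))).map fun u => (p u, q u), ?_, ?_, ?_⟩
  · rw [Measure.map_map measurable_fst (hp.prodMk hq)]
    exact map_quantile hp hpq
  · rw [Measure.map_map measurable_snd (hp.prodMk hq), hm]
    exact map_quantile hq hqq
  · rw [ae_map_iff (hp.prodMk hq).aemeasurable (measurableSet_le measurable_fst measurable_snd)]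
    filter_upwards [ae_restrict_mem measurableSet_Ioo] with u hu
    refine (hpq u hu _).2 (((hqq u (hm ▸ hu) _).1 le_rfl).trans ?_)
    exact ENNReal.toReal_mono (measure_ne_top _ _) (hle _)

/-! ### Strassen's theorem on the line -/

/-- Given `q < p ≤ r < s`, the masses at `p` and `r` are split between `q` and `s` without moving
their barycentres, in such a way that the masses at `q` and `s` have prescribed densities. -/
theorem exists_martingale_splice {B : Type*} [MeasurableSpace B] (Q : Measure B)
    {p q r s : B → ℝ} (hp : Measurable p) (hq : Measurable q) (hr : Measurable r)
    (hs : Measurable s) (h : ∀ᵐ z ∂Q, q z < p z ∧ p z ≤ r z ∧ r z < s z) :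
    ∃ M : Measure (ℝ × ℝ),
      M.map Prod.fst = (Q.withDensity fun z => ENNReal.ofReal (p z - q z)⁻¹).map p +
        (Q.withDensity fun z => ENNReal.ofReal (s z - r z)⁻¹).map r ∧
      M.map Prod.snd = (Q.withDensity fun z => ENNReal.ofReal (p z - q z)⁻¹).map q +
        (Q.withDensity fun z => ENNReal.ofReal (s z - r z)⁻¹).map s ∧
      ∀ A : Set ℝ, MeasurableSet A →
        ∫⁻ z in Prod.fst ⁻¹' A, ENNReal.ofReal (z.2 - z.1) ∂M =
          ∫⁻ z in Prod.fst ⁻¹' A, ENNReal.ofReal (z.1 - z.2) ∂M := by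
  -- The weights moved are a from p to q, b from r to s, and c both from p to s and from r to q.
  -- Exchanging the same amount c keeps the masses received at q and s equal to those leaving p and
  -- r; c = 1/(s - q) is the value that balances both barycentres.
  set a : B → ENNReal := fun z => ENNReal.ofReal ((p z - q z)⁻¹ - (s z - q z)⁻¹)
  set b : B → ENNReal := fun z => ENNReal.ofReal ((s z - r z)⁻¹ - (s z - q z)⁻¹)
  set c : B → ENNReal := fun z => ENNReal.ofReal (s z - q z)⁻¹
  have ham : Measurable a := by fun_prop
  have hbm : Measurable b := by fun_prop
  have hcm : Measurable c := by fun_prop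
  have hac : Q.withDensity a + Q.withDensity c =
      Q.withDensity fun z => ENNReal.ofReal (p z - q z)⁻¹ := by
    rw [← withDensity_add_left ham]
    refine withDensity_congr_ae ?_
    filter_upwards [h] with z ⟨h1, h2, h3⟩
    have : (s z - q z)⁻¹ ≤ (p z - q z)⁻¹ := by
      apply inv_anti₀ <;> linarith
    change ENNReal.ofReal _ + ENNReal.ofReal _ = _
    rw [← ENNReal.ofReal_add (by linarith) (inv_nonneg.2 (by linarith)), sub_add_cancel]
  have hbc : Q.withDensity b + Q.withDensity c =
      Q.withDensity fun z => ENNReal.ofReal (s z - r z)⁻¹ := by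
    rw [← withDensity_add_left hbm]
    refine withDensity_congr_ae ?_
    filter_upwards [h] with z ⟨h1, h2, h3⟩
    have : (s z - q z)⁻¹ ≤ (s z - r z)⁻¹ := by
      apply inv_anti₀ <;> linarith
    change ENNReal.ofReal _ + ENNReal.ofReal _ = _
    rw [← ENNReal.ofReal_add (by linarith) (inv_nonneg.2 (by linarith)), sub_add_cancel]
  refine ⟨(Q.withDensity a).map (fun z => (p z, q z)) + (Q.withDensity c).map (fun z => (p z, s z))
    + ((Q.withDensity b).map (fun z => (r z, s z)) + (Q.withDensity c).map (fun z => (r z, q z))),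
    ?_, ?_, fun A hA => ?_⟩
  · rw [← hac, ← hbc]
    simp only [Measure.map_add _ _ measurable_fst, Measure.map_add _ _ hp, Measure.map_add _ _ hr]
    simp only [Measure.map_map measurable_fst (hp.prodMk hq),
      Measure.map_map measurable_fst (hp.prodMk hs), Measure.map_map measurable_fst (hr.prodMk hs),
      Measure.map_map measurable_fst (hr.prodMk hq)]
    rfl
  · rw [← hac, ← hbc]
    simp only [Measure.map_add _ _ measurable_snd, Measure.map_add _ _ hq, Measure.map_add _ _ hs]
    simp only [Measure.map_map measurable_snd (hp.prodMk hq),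
      Measure.map_map measurable_snd (hp.prodMk hs), Measure.map_map measurable_snd (hr.prodMk hs),
      Measure.map_map measurable_snd (hr.prodMk hq)]
    change (Q.withDensity a).map q + (Q.withDensity c).map s +
      ((Q.withDensity b).map s + (Q.withDensity c).map q) = _
    abel
  · have hA' : MeasurableSet (Prod.fst ⁻¹' A : Set (ℝ × ℝ)) := measurable_fst hA
    have key : ∀ φ : ℝ × ℝ → ENNReal, Measurable φ →
        ∫⁻ z, φ z ∂((Q.withDensity a).map (fun z => (p z, q z)) +
          (Q.withDensity c).map (fun z => (p z, s z)) +
          ((Q.withDensity b).map (fun z => (r z, s z)) +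
          (Q.withDensity c).map (fun z => (r z, q z)))) =
        ∫⁻ z, (a z * φ (p z, q z) + c z * φ (p z, s z)) +
          (b z * φ (r z, s z) + c z * φ (r z, q z)) ∂Q := by
      intro φ hφ
      rw [lintegral_add_measure, lintegral_add_measure, lintegral_add_measure,
        lintegral_map hφ (hp.prodMk hq), lintegral_map hφ (hp.prodMk hs),
        lintegral_map hφ (hr.prodMk hs), lintegral_map hφ (hr.prodMk hq),
        lintegral_withDensity_eq_lintegral_mul _ ham (by fun_prop : Measurable fun z => φ (p z, q z)),
        lintegral_withDensity_eq_lintegral_mul _ hcm (by fun_prop : Measurable fun z => φ (p z, s z)),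
        lintegral_withDensity_eq_lintegral_mul _ hbm (by fun_prop : Measurable fun z => φ (r z, s z)),
        lintegral_withDensity_eq_lintegral_mul _ hcm (by fun_prop : Measurable fun z => φ (r z, q z)),
        lintegral_add_left (by fun_prop), lintegral_add_left (by fun_prop),
        lintegral_add_left (by fun_prop)]
      rfl
    rw [← lintegral_indicator hA', ← lintegral_indicator hA',
      key _ (Measurable.indicator (by fun_prop) hA'), key _ (Measurable.indicator (by fun_prop) hA')]
    refine lintegral_congr_ae ?_
    filter_upwards [h] with z ⟨h1, h2, h3⟩
    have e1 : c z * ENNReal.ofReal (s z - p z) = a z * ENNReal.ofReal (p z - q z) := by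
      have : (s z - q z)⁻¹ ≤ (p z - q z)⁻¹ := by
        apply inv_anti₀ <;> linarith
      rw [← ENNReal.ofReal_mul (inv_nonneg.2 (by linarith)), ← ENNReal.ofReal_mul (by linarith)]
      congr 1
      have : s z - q z ≠ 0 := by linarith
      have : p z - q z ≠ 0 := by linarith
      field_simp
      ring
    have e2 : b z * ENNReal.ofReal (s z - r z) = c z * ENNReal.ofReal (r z - q z) := by
      have : (s z - q z)⁻¹ ≤ (s z - r z)⁻¹ := by
        apply inv_anti₀ <;> linarith
      rw [← ENNReal.ofReal_mul (inv_nonneg.2 (by linarith)), ← ENNReal.ofReal_mul (by linarith)]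
      congr 1
      have : s z - q z ≠ 0 := by linarith
      have : s z - r z ≠ 0 := by linarith
      field_simp
      ring
    have z1 : ENNReal.ofReal (q z - p z) = 0 := ENNReal.ofReal_of_nonpos (by linarith)
    have z2 : ENNReal.ofReal (p z - s z) = 0 := ENNReal.ofReal_of_nonpos (by linarith)
    have z3 : ENNReal.ofReal (r z - s z) = 0 := ENNReal.ofReal_of_nonpos (by linarith)
    have z4 : ENNReal.ofReal (q z - r z) = 0 := ENNReal.ofReal_of_nonpos (by linarith)
    by_cases hpA : p z ∈ A <;> by_cases hrA : r z ∈ A <;>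
      simp [indicator, hpA, hrA, e1, e2, z1, z2, z3, z4]

theorem map_withDensity_comp {α β : Type*} [MeasurableSpace α] [MeasurableSpace β]
    (Q : Measure α) {π : α → β} (hπ : Measurable π) {w : β → ENNReal} (hw : Measurable w) :
    (Q.withDensity fun z => w (π z)).map π = (Q.map π).withDensity w := by
  ext s hs
  rw [Measure.map_apply hπ hs, withDensity_apply _ (hπ hs), withDensity_apply _ hs,
    setLIntegral_map hs hw hπ]

theorem withDensity_ofReal_sub_inv {α : Type*} [MeasurableSpace α] (μ : Measure α)
    {f g : α → ℝ} (hf : Measurable f) (hg : Measurable g) :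
    (μ.withDensity fun u => ENNReal.ofReal (f u - g u)).withDensity
      (fun u => ENNReal.ofReal (f u - g u)⁻¹) = μ.restrict {u | g u < f u} := by
  have h : MeasurableSet {u | g u < f u} := measurableSet_lt hg hf
  rw [← withDensity_mul _ (by fun_prop) (by fun_prop), ← withDensity_indicator_one h]
  congr 1
  ext u
  by_cases hu : g u < f u
  · have h1 : 0 < f u - g u := sub_pos.2 hu
    rw [indicator_of_mem (show u ∈ {u | g u < f u} from hu), Pi.mul_apply,
      ← ENNReal.ofReal_mul h1.le, mul_inv_cancel₀ h1.ne']
    simp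
  · rw [indicator_of_notMem (show u ∉ {u | g u < f u} from hu), Pi.mul_apply,
      ENNReal.ofReal_of_nonpos (by linarith), zero_mul]

/-- The convex order of two functions, in terms of their integrals over initial segments. -/
theorem setIntegral_Iic_le_of_convexOrder {f g : ℝ → ℝ}
    (hgm : MonotoneOn g (Ioo 0 1))
    (hfi : IntegrableOn f (Ioo 0 1)) (hgi : IntegrableOn g (Ioo 0 1))
    (hmean : ∫ u in Ioo 0 1, f u = ∫ u in Ioo 0 1, g u)
    (h : ∀ y : ℝ, ∫ u in Ioo 0 1, max (y - f u) 0 ≤ ∫ u in Ioo 0 1, max (y - g u) 0) (t : ℝ) :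
    ∫ u in Iic t, g u ∂(volume.restrict (Ioo (0 : ℝ) 1)) ≤
      ∫ u in Iic t, f u ∂(volume.restrict (Ioo (0 : ℝ) 1)) := by
  rcases le_or_gt t 0 with h0 | h0
  · have : (volume.restrict (Ioo (0 : ℝ) 1)) (Iic t) = 0 := by
      rw [Measure.restrict_apply measurableSet_Iic]
      convert measure_empty (μ := (volume : Measure ℝ))
      ext u; simp only [mem_inter_iff, mem_Iic, mem_Ioo, mem_empty_iff_false, iff_false]
      intro hu; linarith [hu.1, hu.2.1]
    rw [Measure.restrict_eq_zero.2 this]; simp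
  rcases le_or_gt 1 t with h1 | h1
  · rw [Measure.restrict_restrict measurableSet_Iic,
      inter_eq_self_of_subset_right (fun u hu => hu.2.le.trans h1), hmean]
  set lam := volume.restrict (Ioo (0 : ℝ) 1) with hlam
  set y := g t with hy
  have e1 : ∫ u, max (y - g u) 0 ∂lam = ∫ u in Iic t, (y - g u) ∂lam := by
    rw [← integral_indicator measurableSet_Iic]
    refine integral_congr_ae ?_
    filter_upwards [ae_restrict_mem (μ := volume) (measurableSet_Ioo (a := (0 : ℝ)) (b := 1))]
      with u hu
    by_cases hut : u ≤ t
    · rw [indicator_of_mem (show u ∈ Iic t from hut), max_eq_left]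
      linarith [hgm hu ⟨h0, h1⟩ hut]
    · rw [indicator_of_notMem (show u ∉ Iic t from hut), max_eq_right]
      linarith [hgm ⟨h0, h1⟩ hu (not_le.1 hut).le]
  have hc : Integrable (fun _ : ℝ => y) lam := integrable_const y
  have e2 : ∫ u in Iic t, (y - f u) ∂lam ≤ ∫ u, max (y - f u) 0 ∂lam := by
    have hi : Integrable (fun u => max (y - f u) 0) lam := (hc.sub hfi).pos_part
    calc ∫ u in Iic t, (y - f u) ∂lam ≤ ∫ u in Iic t, max (y - f u) 0 ∂lam :=
          setIntegral_mono (hc.sub hfi).integrableOn hi.integrableOn fun u => le_max_left _ _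
      _ ≤ _ := setIntegral_le_integral hi (ae_of_all _ fun u => le_max_right _ _)
  have e3 := (e2.trans (h y)).trans_eq e1
  rw [integral_sub hc.integrableOn hfi.integrableOn,
    integral_sub hc.integrableOn hgi.integrableOn] at e3
  linarith

/-- Both sides are finite and their difference is the integral of f - g. This turns comparisons of
the masses of (f - g)⁺ and (g - f)⁺ into comparisons of integrals. -/
theorem lintegral_ofReal_sub_le_iff {α : Type*} [MeasurableSpace α] {μ : Measure α}
    {f g : α → ℝ} (hf : Integrable f μ) (hg : Integrable g μ) :
    ∫⁻ u, ENNReal.ofReal (g u - f u) ∂μ ≤ ∫⁻ u, ENNReal.ofReal (f u - g u) ∂μ ↔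
      ∫ u, g u ∂μ ≤ ∫ u, f u ∂μ := by
  have h := integral_eq_lintegral_pos_part_sub_lintegral_neg_part (hf.sub hg)
  simp only [Pi.sub_apply, neg_sub] at h
  have h1 := (hf.sub hg).lintegral_lt_top.ne
  have h2 := (hg.sub hf).lintegral_lt_top.ne
  simp only [Pi.sub_apply] at h1 h2
  rw [integral_sub hf hg] at h
  rw [← ENNReal.toReal_le_toReal h2 h1]
  constructor <;> intro _ <;> linarith

/-- **Strassen's theorem on the line**: two integrable laws with the same mean which are in convex
order are the marginals of a martingale coupling. -/
theorem exists_martingale_coupling (μ ν : Measure ℝ) [IsProbabilityMeasure μ]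
    [IsProbabilityMeasure ν] (hμ : Integrable (fun x : ℝ => x) μ)
    (hν : Integrable (fun x : ℝ => x) ν) (hmean : ∫ x, x ∂μ = ∫ x, x ∂ν)
    (h : ∀ y : ℝ, ∫ x, max (y - x) 0 ∂μ ≤ ∫ x, max (y - x) 0 ∂ν) :
    ∃ M : Measure (ℝ × ℝ), M.map Prod.fst = μ ∧ M.map Prod.snd = ν ∧
      ∀ A : Set ℝ, MeasurableSet A →
        ∫⁻ z in Prod.fst ⁻¹' A, ENNReal.ofReal (z.2 - z.1) ∂M =
          ∫⁻ z in Prod.fst ⁻¹' A, ENNReal.ofReal (z.1 - z.2) ∂M := by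
  obtain ⟨f, hf, hfq⟩ := exists_quantile μ
  obtain ⟨g, hg, hgq⟩ := exists_quantile ν
  have hfmap := map_quantile hf hfq
  have hgmap := map_quantile hg hgq
  have hfm := monotoneOn_quantile hfq
  have hgm := monotoneOn_quantile hgq
  rw [probReal_univ] at hfmap hgmap hfm hgm
  clear hfq hgq
  set lam := volume.restrict (Ioo (0 : ℝ) 1) with hlam
  have hfi : Integrable f lam := by
    rw [← hfmap] at hμ
    exact hμ.comp_measurable hf
  have hgi : Integrable g lam := by
    rw [← hgmap] at hν
    exact hν.comp_measurable hg
  have hmean' : ∫ u, f u ∂lam = ∫ u, g u ∂lam := by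
    rw [← hfmap, ← hgmap, integral_map hf.aemeasurable (by fun_prop),
      integral_map hg.aemeasurable (by fun_prop)] at hmean
    exact hmean
  have hconv : ∀ y : ℝ, ∫ u, max (y - f u) 0 ∂lam ≤ ∫ u, max (y - g u) 0 ∂lam := by
    intro y
    have := h y
    rwa [← hfmap, ← hgmap, integral_map hf.aemeasurable (by fun_prop),
      integral_map hg.aemeasurable (by fun_prop)] at this
  set πp := lam.withDensity fun u => ENNReal.ofReal (f u - g u) with hπp
  set πm := lam.withDensity fun u => ENNReal.ofReal (g u - f u) with hπm
  have hp_fin : IsFiniteMeasure πp := isFiniteMeasure_withDensity_ofReal (hfi.sub hgi).2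
  have hm_fin : IsFiniteMeasure πm := isFiniteMeasure_withDensity_ofReal (hgi.sub hfi).2
  obtain ⟨Q, hQ1, hQ2, hQ⟩ := exists_ordered_coupling πp πm (by
      rw [hπp, hπm, withDensity_apply _ MeasurableSet.univ, withDensity_apply _ MeasurableSet.univ,
        Measure.restrict_univ]
      exact le_antisymm ((lintegral_ofReal_sub_le_iff hgi hfi).2 hmean'.le)
        ((lintegral_ofReal_sub_le_iff hfi hgi).2 hmean'.ge)) (fun t => by
      rw [hπp, hπm, withDensity_apply _ measurableSet_Iic, withDensity_apply _ measurableSet_Iic]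
      exact (lintegral_ofReal_sub_le_iff hfi.integrableOn hgi.integrableOn).2
        (setIntegral_Iic_le_of_convexOrder hgm hfi hgi hmean' hconv t))
  have hdens : ∀ {f g : ℝ → ℝ}, Measurable f → Measurable g →
      ∀ᵐ u ∂(lam.withDensity fun u => ENNReal.ofReal (f u - g u)),
        u ∈ Ioo (0 : ℝ) 1 ∧ g u < f u := by
    intro f g hf hg
    rw [ae_withDensity_iff (by fun_prop)]
    filter_upwards [ae_restrict_mem (μ := volume) (measurableSet_Ioo (a := (0 : ℝ)) (b := 1))]
      with u hu h0
    exact ⟨hu, sub_pos.1 (ENNReal.ofReal_pos.1 (pos_iff_ne_zero.2 h0))⟩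
  have hQp : ∀ᵐ z ∂Q, z.1 ∈ Ioo (0 : ℝ) 1 ∧ g z.1 < f z.1 := by
    have := hdens hf hg
    rw [← hπp, ← hQ1] at this
    exact ae_of_ae_map measurable_fst.aemeasurable this
  have hQm : ∀ᵐ z ∂Q, z.2 ∈ Ioo (0 : ℝ) 1 ∧ f z.2 < g z.2 := by
    have := hdens hg hf
    rw [← hπm, ← hQ2] at this
    exact ae_of_ae_map measurable_snd.aemeasurable this
  obtain ⟨N, hN1, hN2, hN⟩ := exists_martingale_splice Q (p := fun z => f z.1)
    (q := fun z => g z.1) (r := fun z => f z.2) (s := fun z => g z.2)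
    (hf.comp measurable_fst) (hg.comp measurable_fst) (hf.comp measurable_snd)
    (hg.comp measurable_snd) (by
      filter_upwards [hQ, hQp, hQm] with z h0 h1 h2
      exact ⟨h1.2, hfm h1.1 h2.1 h0, h2.2⟩)
  -- The inverse weights of the splice cancel the densities of the marginals of Q, leaving Lebesgue
  -- measure where f and g differ.
  have hrow1 : ∀ k : ℝ → ℝ, Measurable k →
      (Q.withDensity fun z => ENNReal.ofReal (f z.1 - g z.1)⁻¹).map (fun z => k z.1) =
        (lam.restrict {u | g u < f u}).map k := by
    intro k hk
    rw [← withDensity_ofReal_sub_inv lam hf hg, ← hπp, ← hQ1,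
      ← map_withDensity_comp Q measurable_fst (by fun_prop), Measure.map_map hk measurable_fst]
    rfl
  have hrow2 : ∀ k : ℝ → ℝ, Measurable k →
      (Q.withDensity fun z => ENNReal.ofReal (g z.2 - f z.2)⁻¹).map (fun z => k z.2) =
        (lam.restrict {u | f u < g u}).map k := by
    intro k hk
    rw [← withDensity_ofReal_sub_inv lam hg hf, ← hπm, ← hQ2,
      ← map_withDensity_comp Q measurable_snd (by fun_prop), Measure.map_map hk measurable_snd]
    rfl
  have hcover : {u | f u = g u} ∪ ({u | g u < f u} ∪ {u | f u < g u}) = univ := by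
    refine eq_univ_of_forall fun u => ?_
    rcases lt_trichotomy (f u) (g u) with h | h | h
    exacts [Or.inr (Or.inr h), Or.inl h, Or.inr (Or.inl h)]
  have hsplit : lam.restrict {u | f u = g u} +
      (lam.restrict {u | g u < f u} + lam.restrict {u | f u < g u}) = lam := by
    rw [← Measure.restrict_union _ (measurableSet_lt hf hg),
      ← Measure.restrict_union _ ((measurableSet_lt hg hf).union (measurableSet_lt hf hg)),
      hcover, Measure.restrict_univ]
    · rw [Set.disjoint_left]
      intro u hu hu'
      rcases hu' with h' | h'
      · exact absurd hu (ne_of_gt h')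
      · exact absurd hu (ne_of_lt h')
    · rw [Set.disjoint_left]
      exact fun u hu hu' => lt_asymm (a := g u) hu hu'
  refine ⟨(lam.restrict {u | f u = g u}).map (fun u => (f u, g u)) + N, ?_, ?_, fun A hA => ?_⟩
  · rw [Measure.map_add _ _ measurable_fst, hN1, hrow1 f hf, hrow2 f hf,
      Measure.map_map measurable_fst (hf.prodMk hg), ← Measure.map_add _ _ hf]
    change (lam.restrict {u | f u = g u}).map f + _ = _
    rw [← Measure.map_add _ _ hf, hsplit, hfmap]
  · rw [Measure.map_add _ _ measurable_snd, hN2, hrow1 g hg, hrow2 g hg,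
      Measure.map_map measurable_snd (hf.prodMk hg), ← Measure.map_add _ _ hg]
    change (lam.restrict {u | f u = g u}).map g + _ = _
    rw [← Measure.map_add _ _ hg, hsplit, hgmap]
  · have hA' : MeasurableSet (Prod.fst ⁻¹' A : Set (ℝ × ℝ)) := measurable_fst hA
    have hdiag : ∀ᵐ z ∂((lam.restrict {u | f u = g u}).map (fun u => (f u, g u))), z.1 = z.2 := by
      rw [ae_map_iff (hf.prodMk hg).aemeasurable (measurableSet_eq_fun measurable_fst measurable_snd)]
      exact ae_restrict_mem (measurableSet_eq_fun hf hg)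
    rw [Measure.restrict_add, lintegral_add_measure, lintegral_add_measure, hN A hA]
    congr 1
    refine lintegral_congr_ae ?_
    filter_upwards [ae_restrict_of_ae hdiag] with z hz
    rw [hz]

/-! ### Integrated cdfs and the convex order -/

theorem lintegral_Iic_measure_Iic (μ : Measure ℝ) [SFinite μ] (y : ℝ) :
    ∫⁻ t in Iic y, μ (Iic t) = ∫⁻ x, ENNReal.ofReal (y - x) ∂μ := by
  have h1 : ∀ t, μ (Iic t) = ∫⁻ x, {z : ℝ × ℝ | z.2 ≤ z.1}.indicator 1 (t, x) ∂μ := by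
    intro t
    rw [← lintegral_indicator_one measurableSet_Iic]
    rfl
  have hm : Measurable ({z : ℝ × ℝ | z.2 ≤ z.1}.indicator (1 : ℝ × ℝ → ENNReal)) :=
    measurable_one.indicator (measurableSet_le measurable_snd measurable_fst)
  simp_rw [h1]
  rw [lintegral_lintegral_swap (by exact hm.aemeasurable)]
  refine lintegral_congr fun x => ?_
  have h2 : ∀ t, {z : ℝ × ℝ | z.2 ≤ z.1}.indicator (1 : ℝ × ℝ → ENNReal) (t, x) =
      (Ici x).indicator 1 t := fun t => rfl
  simp_rw [h2]
  rw [lintegral_indicator_one measurableSet_Ici, Measure.restrict_apply measurableSet_Ici,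
    Ici_inter_Iic, Real.volume_Icc]

theorem lintegral_Ioi_measure_Ioi (μ : Measure ℝ) [SFinite μ] (y : ℝ) :
    ∫⁻ t in Ioi y, μ (Ioi t) = ∫⁻ x, ENNReal.ofReal (x - y) ∂μ := by
  have h1 : ∀ t, μ (Ioi t) = ∫⁻ x, {z : ℝ × ℝ | z.1 < z.2}.indicator 1 (t, x) ∂μ := by
    intro t
    rw [← lintegral_indicator_one measurableSet_Ioi]
    rfl
  have hm : Measurable ({z : ℝ × ℝ | z.1 < z.2}.indicator (1 : ℝ × ℝ → ENNReal)) :=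
    measurable_one.indicator (measurableSet_lt measurable_fst measurable_snd)
  simp_rw [h1]
  rw [lintegral_lintegral_swap (by exact hm.aemeasurable)]
  refine lintegral_congr fun x => ?_
  have h2 : ∀ t, {z : ℝ × ℝ | z.1 < z.2}.indicator (1 : ℝ × ℝ → ENNReal) (t, x) =
      (Iio x).indicator 1 t := fun t => rfl
  simp_rw [h2]
  rw [lintegral_indicator_one measurableSet_Iio, Measure.restrict_apply measurableSet_Iio,
    Iio_inter_Ioi, Real.volume_Ioo]

section Law

variable {μ ν : Measure ℝ} [IsProbabilityMeasure μ] [IsProbabilityMeasure ν]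

theorem integrable_max_const_sub (hμ : Integrable (fun x : ℝ => x) μ) (y : ℝ) :
    Integrable (fun x => max (y - x) 0) μ :=
  ((integrable_const y).sub hμ).pos_part

theorem integrable_max_sub_const (hμ : Integrable (fun x : ℝ => x) μ) (y : ℝ) :
    Integrable (fun x => max (x - y) 0) μ :=
  (hμ.sub (integrable_const y)).pos_part

theorem ofReal_integral_max_const_sub (hμ : Integrable (fun x : ℝ => x) μ) (y : ℝ) :
    ENNReal.ofReal (∫ x, max (y - x) 0 ∂μ) = ∫⁻ t in Iic y, μ (Iic t) := by
  rw [lintegral_Iic_measure_Iic, ofReal_integral_eq_lintegral_ofReal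
    (integrable_max_const_sub hμ y) (ae_of_all _ fun x => le_max_right _ _)]
  simp [ENNReal.ofReal_max]

theorem ofReal_integral_max_sub_const (hμ : Integrable (fun x : ℝ => x) μ) (y : ℝ) :
    ENNReal.ofReal (∫ x, max (x - y) 0 ∂μ) = ∫⁻ t in Ioi y, μ (Ioi t) := by
  rw [lintegral_Ioi_measure_Ioi, ofReal_integral_eq_lintegral_ofReal
    (integrable_max_sub_const hμ y) (ae_of_all _ fun x => le_max_right _ _)]
  simp [ENNReal.ofReal_max]

theorem integrableOn_cdf_Iic (hμ : Integrable (fun x : ℝ => x) μ) (y : ℝ) :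
    IntegrableOn (fun t => cdf μ t) (Iic y) := by
  refine ⟨(monotone_cdf μ).measurable.aestronglyMeasurable, ?_⟩
  rw [hasFiniteIntegral_iff_ofReal (ae_of_all _ fun t => cdf_nonneg μ t)]
  simp_rw [ofReal_cdf]
  rw [← ofReal_integral_max_const_sub hμ]
  exact ENNReal.ofReal_lt_top

theorem setIntegral_cdf_Iic (hμ : Integrable (fun x : ℝ => x) μ) (y : ℝ) :
    ∫ t in Iic y, cdf μ t = ∫ x, max (y - x) 0 ∂μ := by
  rw [integral_eq_lintegral_of_nonneg_ae (ae_of_all _ fun t => cdf_nonneg μ t)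
    (monotone_cdf μ).measurable.aestronglyMeasurable]
  simp_rw [ofReal_cdf]
  rw [← ofReal_integral_max_const_sub hμ,
    ENNReal.toReal_ofReal (integral_nonneg fun x => le_max_right (_ : ℝ) 0)]

theorem integral_max_const_sub_mono (hμ : Integrable (fun x : ℝ => x) μ)
    (hν : Integrable (fun x : ℝ => x) ν) {y : ℝ} (h : ∀ t < y, cdf μ t ≤ cdf ν t) :
    ∫ x, max (y - x) 0 ∂μ ≤ ∫ x, max (y - x) 0 ∂ν := by
  -- The endpoint y is dropped as a null set: the cdfs are compared only strictly below y.
  rw [← setIntegral_cdf_Iic hμ, ← setIntegral_cdf_Iic hν, integral_Iic_eq_integral_Iio,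
    integral_Iic_eq_integral_Iio]
  exact setIntegral_mono_on ((integrableOn_cdf_Iic hμ y).mono_set Iio_subset_Iic_self)
    ((integrableOn_cdf_Iic hν y).mono_set Iio_subset_Iic_self) measurableSet_Iio h

theorem integral_max_sub_const_mono (hμ : Integrable (fun x : ℝ => x) μ)
    (hν : Integrable (fun x : ℝ => x) ν) {y : ℝ} (h : ∀ t, y ≤ t → cdf ν t ≤ cdf μ t) :
    ∫ x, max (x - y) 0 ∂μ ≤ ∫ x, max (x - y) 0 ∂ν := by
  rw [← ENNReal.ofReal_le_ofReal_iff (integral_nonneg fun x => le_max_right (_ : ℝ) 0),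
    ofReal_integral_max_sub_const hμ, ofReal_integral_max_sub_const hν]
  refine setLIntegral_mono' measurableSet_Ioi fun t ht => ?_
  rw [← compl_Iic, prob_compl_eq_one_sub measurableSet_Iic,
    prob_compl_eq_one_sub measurableSet_Iic, ← ofReal_cdf, ← ofReal_cdf]
  exact tsub_le_tsub_left (ENNReal.ofReal_le_ofReal (h t (le_of_lt ht))) _

/-- Put-call parity: with equal means, comparing upper tails is the same as comparing lower ones. -/
theorem integral_max_sub_const (hμ : Integrable (fun x : ℝ => x) μ) (y : ℝ) :
    ∫ x, max (x - y) 0 ∂μ = ∫ x, max (y - x) 0 ∂μ + ∫ x, x ∂μ - y := by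
  have h : ∀ x : ℝ, max (x - y) 0 = max (y - x) 0 + x - y := by
    intro x
    rcases le_total x y with hx | hx
    · rw [max_eq_right (by linarith), max_eq_left (by linarith)]; ring
    · rw [max_eq_left (by linarith), max_eq_right (by linarith)]; ring
  simp_rw [h]
  have h1 := integrable_max_const_sub hμ y
  rw [integral_sub (by exact h1.add hμ) (integrable_const y), integral_add h1 hμ]
  simp

/-- First-order stochastic dominance orders the means. -/
theorem integral_id_mono (hμ : Integrable (fun x : ℝ => x) μ)
    (hν : Integrable (fun x : ℝ => x) ν) (h : ∀ t, cdf ν t ≤ cdf μ t) :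
    ∫ x, x ∂μ ≤ ∫ x, x ∂ν := by
  have h1 := integral_max_const_sub_mono hν hμ (y := 0) fun t _ => h t
  have h2 := integral_max_sub_const_mono hμ hν (y := 0) fun t _ => h t
  rw [integral_max_sub_const hμ, integral_max_sub_const hν] at h2
  linarith

/-- A cut criterion for the convex order of two laws with the same mean. -/
theorem integral_max_const_sub_le_of_cut (hμ : Integrable (fun x : ℝ => x) μ)
    (hν : Integrable (fun x : ℝ => x) ν) (hmean : ∫ x, x ∂μ = ∫ x, x ∂ν) {y : ℝ}
    (h : (∀ t < y, cdf μ t ≤ cdf ν t) ∨ (∀ t, y ≤ t → cdf ν t ≤ cdf μ t)) :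
    ∫ x, max (y - x) 0 ∂μ ≤ ∫ x, max (y - x) 0 ∂ν := by
  rcases h with h | h
  · exact integral_max_const_sub_mono hμ hν h
  · have h2 := integral_max_sub_const_mono hμ hν h
    rw [integral_max_sub_const hμ, integral_max_sub_const hν] at h2
    linarith

end Law

/-! ### Conditional expectations and martingale couplings -/

/-- Jensen's inequality for `x ↦ max (y - x) 0` and conditional expectations. -/
theorem integral_max_const_sub_condExp_le {Ω : Type v} {I m : MeasurableSpace Ω} {P : Measure Ω}
    [IsProbabilityMeasure P] (hI : I ≤ m) {Y ψ : Ω → ℝ} (hY : Integrable Y P)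
    (hψm : Measurable[I] ψ) (h : P[Y | I] =ᵐ[P] ψ) (y : ℝ) :
    ∫ ω, max (y - ψ ω) 0 ∂P ≤ ∫ ω, max (y - Y ω) 0 ∂P := by
  have hψ : Integrable ψ P := integrable_condExp.congr h
  have hA : MeasurableSet[I] {ω | ψ ω < y} := hψm measurableSet_Iio
  have hc : Integrable (fun _ : Ω => y) P := integrable_const y
  have hYp : Integrable (fun ω => max (y - Y ω) 0) P := (hc.sub hY).pos_part
  calc ∫ ω, max (y - ψ ω) 0 ∂P = ∫ ω in {ω | ψ ω < y}, (y - ψ ω) ∂P := by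
        rw [← integral_indicator (hI _ hA)]
        refine integral_congr_ae (ae_of_all _ fun ω => ?_)
        by_cases hω : ψ ω < y
        · rw [indicator_of_mem (show ω ∈ {ω | ψ ω < y} from hω)]
          exact max_eq_left (by linarith)
        · rw [indicator_of_notMem (show ω ∉ {ω | ψ ω < y} from hω)]
          exact max_eq_right (by linarith)
    _ = ∫ ω in {ω | ψ ω < y}, (y - Y ω) ∂P := by
        rw [integral_sub hc.integrableOn hψ.integrableOn,
          integral_sub hc.integrableOn hY.integrableOn, ← setIntegral_condExp hI hY hA,
          setIntegral_congr_ae (hI _ hA) (h.mono fun ω hω _ => hω.symm)]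
    _ ≤ ∫ ω in {ω | ψ ω < y}, max (y - Y ω) 0 ∂P :=
        setIntegral_mono (hc.sub hY).integrableOn hYp.integrableOn fun ω => le_max_left _ _
    _ ≤ ∫ ω, max (y - Y ω) 0 ∂P :=
        setIntegral_le_integral hYp (ae_of_all _ fun ω => le_max_right _ _)

/-- A martingale coupling on the plane, read as a conditional expectation on a space in an
arbitrary universe. -/
theorem exists_condExp_eq_of_martingale_coupling {μ ν : Measure ℝ} [IsProbabilityMeasure μ]
    (hμ : Integrable (fun x : ℝ => x) μ) (hν : Integrable (fun x : ℝ => x) ν)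
    {M : Measure (ℝ × ℝ)} (h1 : M.map Prod.fst = μ) (h2 : M.map Prod.snd = ν)
    (hM : ∀ A : Set ℝ, MeasurableSet A →
        ∫⁻ z in Prod.fst ⁻¹' A, ENNReal.ofReal (z.2 - z.1) ∂M =
          ∫⁻ z in Prod.fst ⁻¹' A, ENNReal.ofReal (z.1 - z.2) ∂M) :
    ∃ (Ω : Type v) (I mΩ : MeasurableSpace Ω) (P : Measure Ω) (_ : IsProbabilityMeasure P)
      (Y ψ : Ω → ℝ), I ≤ mΩ ∧ Measurable Y ∧ Measurable ψ ∧
        MeasurableSpace.comap ψ Real.measurableSpace ≤ I ∧ P.map Y = ν ∧ P.map ψ = μ ∧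
        P[Y | I] =ᵐ[P] ψ := by
  have hup : Measurable (ULift.up.{v} : ℝ × ℝ → ULift.{v} (ℝ × ℝ)) := measurable_up
  have hdown : Measurable (ULift.down.{v} : ULift.{v} (ℝ × ℝ) → ℝ × ℝ) := measurable_down
  have hYm : Measurable fun z : ULift.{v} (ℝ × ℝ) => z.down.2 := measurable_snd.comp hdown
  have hψm : Measurable fun z : ULift.{v} (ℝ × ℝ) => z.down.1 := measurable_fst.comp hdown
  have hY : (M.map ULift.up.{v}).map (fun z => z.down.2) = ν := by
    rw [Measure.map_map hYm hup, ← h2]; rfl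
  have hψ : (M.map ULift.up.{v}).map (fun z => z.down.1) = μ := by
    rw [Measure.map_map hψm hup, ← h1]; rfl
  have hprob : IsProbabilityMeasure (M.map ULift.up.{v}) := by
    constructor
    have := measure_univ (μ := μ)
    rwa [← hψ, Measure.map_apply hψm MeasurableSet.univ, preimage_univ] at this
  have hYi : Integrable (fun z : ULift.{v} (ℝ × ℝ) => z.down.2) (M.map ULift.up.{v}) := by
    rw [← hY] at hν
    exact hν.comp_measurable hYm
  have hψi : Integrable (fun z : ULift.{v} (ℝ × ℝ) => z.down.1) (M.map ULift.up.{v}) := by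
    rw [← hψ] at hμ
    exact hμ.comp_measurable hψm
  have hI : MeasurableSpace.comap (fun z : ULift.{v} (ℝ × ℝ) => z.down.1) Real.measurableSpace ≤
      (inferInstance : MeasurableSpace (ULift.{v} (ℝ × ℝ))) := hψm.comap_le
  refine ⟨ULift.{v} (ℝ × ℝ), MeasurableSpace.comap (fun z => z.down.1) Real.measurableSpace,
    inferInstance, M.map ULift.up, hprob, fun z => z.down.2, fun z => z.down.1, hI, hYm, hψm,
    le_rfl, hY, hψ, ?_⟩
  -- The events of σ(ψ) are the preimages of Borel sets under the first coordinate, exactly those on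
  -- which the coupling is balanced.
  refine (ae_eq_condExp_of_forall_setIntegral_eq hI hYi (fun s _ _ => hψi.integrableOn) ?_
    (comap_measurable _).aestronglyMeasurable).symm
  rintro s ⟨A, hA, rfl⟩ -
  have hm : ∀ φ : ℝ × ℝ → ENNReal, Measurable φ →
      ∫⁻ z in (fun z : ULift.{v} (ℝ × ℝ) => z.down.1) ⁻¹' A, φ z.down ∂(M.map ULift.up.{v}) =
        ∫⁻ z in Prod.fst ⁻¹' A, φ z ∂M := by
    intro φ hφ
    rw [setLIntegral_map (hψm hA) (by exact hφ.comp hdown) hup]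
    rfl
  have h := integral_eq_lintegral_pos_part_sub_lintegral_neg_part
    (hYi.sub hψi).integrableOn.integrable (μ := (M.map ULift.up.{v}).restrict
      ((fun z : ULift.{v} (ℝ × ℝ) => z.down.1) ⁻¹' A))
  simp only [Pi.sub_apply, neg_sub] at h
  rw [hm (fun z => ENNReal.ofReal (z.2 - z.1)) (by fun_prop),
    hm (fun z => ENNReal.ofReal (z.1 - z.2)) (by fun_prop), hM A hA, sub_self,
    integral_sub hYi.integrableOn hψi.integrableOn, sub_eq_zero] at h
  exact h.symm

/-! ### The clipped beliefs and their means -/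

section Pointwise

variable {Ω : Type u} {ψL ψU : Ω → ℝ} {ω : Ω}

theorem psiB_bot (ψL ψU : Ω → ℝ) : psiB ψL ψU ⊥ = ψL := by
  funext ω; simp [psiB]

theorem psiB_top (ψL ψU : Ω → ℝ) : psiB ψL ψU ⊤ = ψU := by
  funext ω; simp [psiB]

theorem psiB_coe (h : ψL ω ≤ ψU ω) (b : ℝ) :
    psiB ψL ψU (b : EReal) ω = max (ψL ω) (min b (ψU ω)) := by
  rw [psiB, if_neg (EReal.coe_ne_bot b), if_neg (EReal.coe_ne_top b), EReal.toReal_coe]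
  split_ifs with h2
  · rw [min_eq_right h2.le, max_eq_right h]
  · rw [min_eq_left (not_lt.1 h2), max_comm]

theorem le_psiB (h : ψL ω ≤ ψU ω) (b : EReal) : ψL ω ≤ psiB ψL ψU b ω := by
  induction b with
  | bot => rw [psiB_bot]
  | top => rwa [psiB_top]
  | coe b => rw [psiB_coe h]; exact le_max_left _ _

theorem psiB_le (h : ψL ω ≤ ψU ω) (b : EReal) : psiB ψL ψU b ω ≤ ψU ω := by
  induction b with
  | bot => rwa [psiB_bot]
  | top => rw [psiB_top]
  | coe b => rw [psiB_coe h]; exact max_le h (min_le_right _ _)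

theorem psiB_mono (h : ψL ω ≤ ψU ω) {b c : EReal} (hbc : b ≤ c) :
    psiB ψL ψU b ω ≤ psiB ψL ψU c ω := by
  induction b with
  | bot => rw [psiB_bot]; exact le_psiB h c
  | top => rw [top_le_iff.1 hbc]
  | coe b =>
    induction c with
    | bot => exact absurd hbc (by simp)
    | top => rw [psiB_top]; exact psiB_le h _
    | coe c =>
      rw [psiB_coe h, psiB_coe h]
      exact max_le_max le_rfl (min_le_min (EReal.coe_le_coe_iff.1 hbc) le_rfl)

end Pointwise

theorem integrable_id_map {Ω : Type u} [MeasurableSpace Ω] {P : Measure Ω}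
    {X : Ω → ℝ} (hX : Integrable X P) :
    Integrable (fun x : ℝ => x) (P.map X) :=
  (integrable_map_measure aestronglyMeasurable_id hX.aemeasurable).2 hX

theorem integral_id_map {Ω : Type u} [MeasurableSpace Ω] {P : Measure Ω}
    {X : Ω → ℝ} (hX : Integrable X P) :
    ∫ x, x ∂(P.map X) = ∫ ω, X ω ∂P :=
  integral_map hX.aemeasurable aestronglyMeasurable_id

variable {Ω : Type u} [MeasurableSpace Ω] {P : Measure Ω} [IsProbabilityMeasure P]
  {Y ψL ψU : Ω → ℝ}

theorem integrable_psiB (hL : Integrable ψL P) (hU : Integrable ψU P)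
    (hLU : ∀ᵐ ω ∂P, ψL ω ≤ ψU ω) (b : EReal) : Integrable (psiB ψL ψU b) P := by
  induction b with
  | bot => rwa [psiB_bot]
  | top => rwa [psiB_top]
  | coe b =>
    refine Integrable.congr (hL.sup ((integrable_const b).inf hU)) ?_
    filter_upwards [hLU] with ω hω
    rw [psiB_coe hω]
    rfl

theorem measure_cdfOf {X : Ω → ℝ} (hX : Integrable X P) : (cdfOf P X).measure = P.map X := by
  have := Measure.isProbabilityMeasure_map hX.aemeasurable
  exact measure_cdf _

theorem deltaMean_cdfOf {X : Ω → ℝ} (hX : Integrable X P) :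
    deltaMean P Y (cdfOf P X) = ∫ ω, Y ω ∂P - ∫ ω, X ω ∂P := by
  rw [deltaMean, measure_cdfOf hX, integral_id_map hX]

theorem integrableOn_cdfOf {X : Ω → ℝ} (hX : Integrable X P) (y : ℝ) :
    IntegrableOn (fun t => cdfOf P X t) (Iic y) := by
  have := Measure.isProbabilityMeasure_map hX.aemeasurable
  exact integrableOn_cdf_Iic (integrable_id_map hX) y

/-- `Δ_F(y)` is the difference of the expected payoffs of two puts with strike `y`. -/
theorem Delta_cdfOf {X : Ω → ℝ} (hY : Integrable Y P) (hX : Integrable X P) (y : ℝ) :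
    Delta P Y (cdfOf P X) y =
      ∫ x, max (y - x) 0 ∂(P.map Y) - ∫ x, max (y - x) 0 ∂(P.map X) := by
  have := Measure.isProbabilityMeasure_map hX.aemeasurable
  have := Measure.isProbabilityMeasure_map hY.aemeasurable
  rw [Delta, integral_sub (integrableOn_cdfOf hY y) (integrableOn_cdfOf hX y),
    ← setIntegral_cdf_Iic (integrable_id_map hX), ← setIntegral_cdf_Iic (integrable_id_map hY)]
  rfl

theorem cdfOf_anti {X Z : Ω → ℝ} (hX : Integrable X P) (hZ : Integrable Z P)
    (h : ∀ᵐ ω ∂P, X ω ≤ Z ω) (t : ℝ) : cdfOf P Z t ≤ cdfOf P X t := by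
  have := Measure.isProbabilityMeasure_map hX.aemeasurable
  have := Measure.isProbabilityMeasure_map hZ.aemeasurable
  rw [cdfOf, cdfOf, cdf_eq_real, cdf_eq_real, measureReal_def, measureReal_def,
    Measure.map_apply_of_aemeasurable hX.aemeasurable measurableSet_Iic,
    Measure.map_apply_of_aemeasurable hZ.aemeasurable measurableSet_Iic]
  refine ENNReal.toReal_mono (measure_ne_top _ _) (measure_mono_ae ?_)
  filter_upwards [h] with ω hω hZt
  exact hω.trans hZt

/-- The switch from F_U to F_L happens at b, so the first case covers y ≤ b and the second b ≤ y.
Either way F^b is extremal on one side of y. -/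
theorem cdfOf_psiB_cut (hL : AEMeasurable ψL P) (hU : AEMeasurable ψU P)
    (hLU : ∀ᵐ ω ∂P, ψL ω ≤ ψU ω) (b : EReal) (y : ℝ) :
    (∀ t < y, cdfOf P (psiB ψL ψU b) t = cdfOf P ψU t) ∨
      (∀ t, y ≤ t → cdfOf P (psiB ψL ψU b) t = cdfOf P ψL t) := by
  induction b with
  | bot => rw [psiB_bot]; exact Or.inr fun _ _ => rfl
  | top => rw [psiB_top]; exact Or.inl fun _ _ => rfl
  | coe b =>
    rcases le_total y b with h | h
    · exact Or.inl fun t ht => by rw [cdfOf_psiB P hL hU hLU, if_pos (ht.trans_le h)]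
    · exact Or.inr fun t ht => by rw [cdfOf_psiB P hL hU hLU, if_neg (not_lt.2 (h.trans ht))]

/-- Ordered integrable variables with equal means agree almost surely. Different b may give the same
mean, so only the cdf is unique. -/
theorem cdfOf_psiB_eq_of_integral_eq (hL : Integrable ψL P) (hU : Integrable ψU P)
    (hLU : ∀ᵐ ω ∂P, ψL ω ≤ ψU ω) {b c : EReal}
    (h : ∫ ω, psiB ψL ψU b ω ∂P = ∫ ω, psiB ψL ψU c ω ∂P) :
    cdfOf P (psiB ψL ψU b) = cdfOf P (psiB ψL ψU c) := by
  wlog hbc : b ≤ c generalizing b c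
  · exact (this h.symm (le_of_not_ge hbc)).symm
  have hae : psiB ψL ψU b =ᵐ[P] psiB ψL ψU c := by
    refine (integral_eq_iff_of_ae_le (integrable_psiB hL hU hLU b)
      (integrable_psiB hL hU hLU c) ?_).1 h
    filter_upwards [hLU] with ω hω
    exact psiB_mono hω hbc
  rw [cdfOf, cdfOf, Measure.map_congr hae]

theorem exists_integral_psiB_eq (hL : Integrable ψL P) (hU : Integrable ψU P)
    (hLU : ∀ᵐ ω ∂P, ψL ω ≤ ψU ω) {m : ℝ} (h1 : ∫ ω, ψL ω ∂P ≤ m) (h2 : m ≤ ∫ ω, ψU ω ∂P) :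
    ∃ b : EReal, ∫ ω, psiB ψL ψU b ω ∂P = m := by
  rcases h1.eq_or_lt with h1 | h1
  -- The extreme means may fail to be attained at a real b. Once both inequalities are strict, the
  -- limits at ±∞ and the intermediate value theorem give a real b.
  · exact ⟨⊥, by rw [psiB_bot, h1]⟩
  rcases h2.eq_or_lt with h2 | h2
  · exact ⟨⊤, by rw [psiB_top, h2]⟩
  have hform : ∀ᵐ ω ∂P, ∀ b : ℝ, psiB ψL ψU (b : EReal) ω = max (ψL ω) (min b (ψU ω)) := by
    filter_upwards [hLU] with ω hω b using psiB_coe hω b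
  have hbound : ∀ b : EReal, ∀ᵐ ω ∂P, ‖psiB ψL ψU b ω‖ ≤ |ψL ω| + |ψU ω| := by
    intro b
    filter_upwards [hLU] with ω hω
    have h3 := le_psiB hω b
    have h4 := psiB_le hω b
    rw [Real.norm_eq_abs, abs_le]
    constructor
    · linarith [neg_abs_le (ψL ω), abs_nonneg (ψU ω)]
    · linarith [le_abs_self (ψU ω), abs_nonneg (ψL ω)]
  have hbi : Integrable (fun ω => |ψL ω| + |ψU ω|) P := hL.abs.add hU.abs
  have hmeas : ∀ b : ℝ, AEStronglyMeasurable (psiB ψL ψU (b : EReal)) P :=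
    fun b => (integrable_psiB hL hU hLU b).aestronglyMeasurable
  have hcont : Continuous fun b : ℝ => ∫ ω, psiB ψL ψU (b : EReal) ω ∂P := by
    refine continuous_of_dominated hmeas (fun b => hbound b) hbi ?_
    filter_upwards [hform] with ω hω
    simp_rw [hω]
    fun_prop
  have hbot : Tendsto (fun b : ℝ => ∫ ω, psiB ψL ψU (b : EReal) ω ∂P) atBot
      (𝓝 (∫ ω, ψL ω ∂P)) := by
    refine tendsto_integral_filter_of_dominated_convergence _ (Eventually.of_forall hmeas)
      (Eventually.of_forall fun b => hbound b) hbi ?_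
    filter_upwards [hform] with ω hω
    refine tendsto_const_nhds.congr' ?_
    filter_upwards [eventually_le_atBot (ψL ω)] with b hb
    rw [hω, max_eq_left ((min_le_left _ _).trans hb)]
  have htop : Tendsto (fun b : ℝ => ∫ ω, psiB ψL ψU (b : EReal) ω ∂P) atTop
      (𝓝 (∫ ω, ψU ω ∂P)) := by
    refine tendsto_integral_filter_of_dominated_convergence _ (Eventually.of_forall hmeas)
      (Eventually.of_forall fun b => hbound b) hbi ?_
    filter_upwards [hform, hLU] with ω hω hω'
    refine tendsto_const_nhds.congr' ?_
    filter_upwards [eventually_ge_atTop (ψU ω)] with b hb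
    rw [hω, min_eq_right hb, max_eq_right hω']
  obtain ⟨b, hb⟩ := mem_range_of_exists_le_of_exists_ge hcont
    ((hbot.eventually (eventually_le_nhds h1)).exists)
    ((htop.eventually (eventually_ge_nhds h2)).exists)
  exact ⟨b, hb⟩

/-! ### The two implications -/

/-- Stochastic dominance bounds the mean of ψ', which is E[Y]. The law of ψ' then lies between F^b
and F_Y in convex order, by the crossing argument on one side and Jensen on the other. -/
theorem mean_bounds_of_H0B (hY : Integrable Y P) (hL : Integrable ψL P) (hU : Integrable ψU P)
    (hLU : ∀ᵐ ω ∂P, ψL ω ≤ ψU ω) (h : H0B.{u, v} P Y ψL ψU) :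
    ((∫ ω, ψL ω ∂P) ≤ (∫ ω, Y ω ∂P) ∧ (∫ ω, Y ω ∂P) ≤ (∫ ω, ψU ω ∂P)) ∧
      ∀ b : EReal, ∫ ω, psiB ψL ψU b ω ∂P = ∫ ω, Y ω ∂P →
        ∀ y, 0 ≤ Delta P Y (cdfOf P (psiB ψL ψU b)) y := by
  obtain ⟨Ω', I', mΩ', P', hP', Y', ψ', hI, hYm, hcomap, hid, hcdf, hce⟩ := h
  have hψm : Measurable[I'] ψ' := measurable_iff_comap_le.2 hcomap
  have hY' : Integrable Y' P' := hid.integrable_iff.2 hY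
  have hψ' : Integrable ψ' P' := integrable_condExp.congr hce
  have hmean : ∫ ω, ψ' ω ∂P' = ∫ ω, Y ω ∂P := by
    rw [← hid.integral_eq, ← integral_condExp hI (f := Y'), integral_congr_ae hce]
  have := Measure.isProbabilityMeasure_map hψ'.aemeasurable
  have := Measure.isProbabilityMeasure_map hL.aemeasurable
  have := Measure.isProbabilityMeasure_map hU.aemeasurable
  have hψ'i := integrable_id_map hψ'
  refine ⟨⟨?_, ?_⟩, fun b hb y => ?_⟩
  · rw [← hmean, ← integral_id_map hL, ← integral_id_map hψ']
    exact integral_id_mono (integrable_id_map hL) hψ'i fun t => (hcdf t).2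
  · rw [← hmean, ← integral_id_map hU, ← integral_id_map hψ']
    exact integral_id_mono hψ'i (integrable_id_map hU) fun t => (hcdf t).1
  · have hB := integrable_psiB hL hU hLU b
    have := Measure.isProbabilityMeasure_map hB.aemeasurable
    rw [Delta_cdfOf hY hB, sub_nonneg]
    calc ∫ x, max (y - x) 0 ∂(P.map (psiB ψL ψU b)) ≤ ∫ x, max (y - x) 0 ∂(P'.map ψ') := by
          refine integral_max_const_sub_le_of_cut (integrable_id_map hB) hψ'i ?_ ?_
          · rw [integral_id_map hB, integral_id_map hψ', hb, hmean]
          · rcases cdfOf_psiB_cut hL.aemeasurable hU.aemeasurable hLU b y with h | h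
            · exact Or.inl fun t ht => (h t ht).trans_le (hcdf t).1
            · exact Or.inr fun t ht => (hcdf t).2.trans_eq (h t ht).symm
      _ = ∫ ω, max (y - ψ' ω) 0 ∂P' := integral_map hψ'.aemeasurable (by fun_prop)
      _ ≤ ∫ ω, max (y - Y' ω) 0 ∂P' := integral_max_const_sub_condExp_le hI hY' hψm hce y
      _ = ∫ x, max (y - x) 0 ∂(P'.map Y') :=
          (integral_map (f := fun x => max (y - x) 0) hY'.aemeasurable (by fun_prop)).symm
      _ = ∫ x, max (y - x) 0 ∂(P.map Y) := by rw [hid.map_eq]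

/-- The law F^b itself serves as that of ψ': it is admissible because ψL ≤ ψ^b ≤ ψU almost surely.
-/
theorem H0B_of_Delta_nonneg (hY : Integrable Y P) (hL : Integrable ψL P) (hU : Integrable ψU P)
    (hLU : ∀ᵐ ω ∂P, ψL ω ≤ ψU ω) {b : EReal}
    (hb : ∫ ω, psiB ψL ψU b ω ∂P = ∫ ω, Y ω ∂P)
    (h : ∀ y, 0 ≤ Delta P Y (cdfOf P (psiB ψL ψU b)) y) : H0B.{u, v} P Y ψL ψU := by
  have hB := integrable_psiB hL hU hLU b
  have := Measure.isProbabilityMeasure_map hB.aemeasurable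
  have := Measure.isProbabilityMeasure_map hY.aemeasurable
  obtain ⟨M, hM1, hM2, hM⟩ := exists_martingale_coupling (P.map (psiB ψL ψU b)) (P.map Y)
    (integrable_id_map hB) (integrable_id_map hY)
    (by rw [integral_id_map hB, integral_id_map hY, hb])
    (fun y => by have := h y; rwa [Delta_cdfOf hY hB, sub_nonneg] at this)
  obtain ⟨Ω', I', mΩ', P', hP', Y', ψ', hI, hYm, hψm, hcomap, hYlaw, hψlaw, hce⟩ :=
    exists_condExp_eq_of_martingale_coupling (integrable_id_map hB) (integrable_id_map hY)
      hM1 hM2 hM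
  refine ⟨Ω', I', mΩ', P', hP', Y', ψ', hI, hYm, hcomap,
    ⟨hYm.aemeasurable, hY.aemeasurable, hYlaw⟩, fun t => ?_, hce⟩
  have hcdf : cdfOf P' ψ' = cdfOf P (psiB ψL ψU b) := by rw [cdfOf, cdfOf, hψlaw]
  rw [hcdf]
  exact ⟨cdfOf_anti hB hU (hLU.mono fun ω hω => psiB_le hω b) t,
    cdfOf_anti hL hB (hLU.mono fun ω hω => le_psiB hω b) t⟩

end BeliefBounds

theorem mainTheorem9 {Ω : Type u} [MeasurableSpace Ω] (P : Measure Ω) [IsProbabilityMeasure P]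
    (Y ψL ψU : Ω → ℝ)
    (hY : Integrable Y P) (hL : Integrable ψL P) (hU : Integrable ψU P)
    (hLU : ∀ᵐ ω ∂P, ψL ω ≤ ψU ω) :
    -- the integrals defining `δ_F` and `Δ_F` converge for every `F` of the family
    (∀ F ∈ familyB P ψL ψU, Integrable (fun x : ℝ => x) F.measure ∧
      ∀ y : ℝ, IntegrableOn (fun t => cdfOf P Y t - F t) (Set.Iic y)) ∧
    -- existence and uniqueness of `F*`
    ((∫ ω, ψL ω ∂P) ≤ (∫ ω, Y ω ∂P) ∧ (∫ ω, Y ω ∂P) ≤ (∫ ω, ψU ω ∂P) →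
      ∃! F : StieltjesFunction ℝ, F ∈ familyB P ψL ψU ∧ deltaMean P Y F = 0) ∧
    -- the equivalence
    (H0B.{u, v} P Y ψL ψU ↔
      ((∫ ω, ψL ω ∂P) ≤ (∫ ω, Y ω ∂P) ∧ (∫ ω, Y ω ∂P) ≤ (∫ ω, ψU ω ∂P)) ∧
      ∃ F : StieltjesFunction ℝ, (F ∈ familyB P ψL ψU ∧ deltaMean P Y F = 0) ∧
        ∀ y : ℝ, 0 ≤ Delta P Y F y) := by
  refine ⟨?_, ?_, ?_, ?_⟩
  · rintro F ⟨b, rfl⟩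
    have hB := integrable_psiB hL hU hLU b
    refine ⟨?_, fun y => (integrableOn_cdfOf hY y).sub (integrableOn_cdfOf hB y)⟩
    change Integrable (fun x : ℝ => x) (cdfOf P (psiB ψL ψU b)).measure
    rw [measure_cdfOf hB]
    exact integrable_id_map hB
  · rintro ⟨h1, h2⟩
    obtain ⟨b, hb⟩ := exists_integral_psiB_eq hL hU hLU h1 h2
    refine ⟨cdfOf P (psiB ψL ψU b), ⟨⟨b, rfl⟩, ?_⟩, ?_⟩
    · rw [deltaMean_cdfOf (integrable_psiB hL hU hLU b), hb, sub_self]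
    · rintro F ⟨⟨c, rfl⟩, hc⟩
      refine cdfOf_psiB_eq_of_integral_eq hL hU hLU ?_
      have hc' : deltaMean P Y (cdfOf P (psiB ψL ψU c)) = 0 := hc
      rw [deltaMean_cdfOf (integrable_psiB hL hU hLU c), sub_eq_zero] at hc'
      rw [hb, hc']
  · intro h
    obtain ⟨hmean, hΔ⟩ := mean_bounds_of_H0B hY hL hU hLU h
    obtain ⟨b, hb⟩ := exists_integral_psiB_eq hL hU hLU hmean.1 hmean.2
    refine ⟨hmean, cdfOf P (psiB ψL ψU b), ⟨⟨b, rfl⟩, ?_⟩, hΔ b hb⟩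
    rw [deltaMean_cdfOf (integrable_psiB hL hU hLU b), hb, sub_self]
  · rintro ⟨-, F, ⟨⟨b, rfl⟩, hb⟩, hΔ⟩
    have hb' : deltaMean P Y (cdfOf P (psiB ψL ψU b)) = 0 := hb
    rw [deltaMean_cdfOf (integrable_psiB hL hU hLU b), sub_eq_zero] at hb'
    exact H0B_of_Delta_nonneg hY hL hU hLU hb'.symm hΔ
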